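/- Let $\|\cdot\|$ be a norm on $\mathbb{R}^d$, let $\alpha>0$, and let $(\mathbf X(\mathbf t):\mathbf t\in\mathbb{Z}^k)$ be a stationary $\mathbb{R}^d$-valued random field that is jointly regularly varying with index $\alpha$. That is, for every nonempty finite set $\{\mathbf t_1,\dots,\mathbf t_n\}\subset\mathbb{Z}^k$ there are a function $V$, regularly varying at infinity with exponent $-\alpha$, and a nonzero Radon measure $\mu$ on $[-\infty,\infty]^{nd}\setminus\{\mathbf 0\}$, not charging points with an infinite coordinate, such that $\mathbb{P}\bigl(x^{-1}(\mathbf X(\mathbf t_1),\dots,\mathbf X(\mathbf t_n))\in\cdot\bigr)/V(x)\to\mu$ vaguely on $[-\infty,\infty]^{nd}\setminus\{\mathbf 0\}$ as $x\to\infty$. Let $(\mathbf Y(\mathbf t):\mathbf t\in\mathbb{Z}^k)$ be the tail field of $\mathbf X$, i.e. the random field whose law is the limit, in the sense of convergence of finite-dimensional distributions, of the conditional laws of $(x^{-1}\mathbf X(\mathbf t):\mathbf t\in\mathbb{Z}^k)$ given $\|\mathbf X(\mathbf 0)\|>x$, as $x\to\infty$. Let $\boldsymbol\Theta(\mathbf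 t)=\mathbf Y(\mathbf t)/\|\mathbf Y(\mathbf 0)\|$, $\mathbf t\in\mathbb{Z}^k$, be the corresponding spectral field. Then for every bounded measurable function $g:(\mathbb{R}^d)^{\mathbb{Z}^k}\to\mathbb{R}$ and every $\mathbf s\in\mathbb{Z}^k$, $$\mathbb{E}\bigl[g(\mathbf Y(\cdot-\mathbf s))\,\mathbf 1(\mathbf Y(-\mathbf s)\neq\mathbf 0)\bigr]=\int_0^\infty \mathbb{E}\bigl[g(r\boldsymbol\Theta(\cdot))\,\mathbf 1(r\|\boldsymbol\Theta(\mathbf s)\|>1)\bigr]\,d(-r^{-\alpha}),$$ $$\mathbb{E}\bigl[g(\boldsymbol\Theta(\cdot-\mathbf s))\,\mathbf 1(\boldsymbol\Theta(-\mathbf s)\neq\mathbf 0)\bigr]=\mathbb{E}\left[g\left(\frac{\boldsymbol\Theta(\cdot)}{\|\boldsymbol\Theta(\mathbf s)\|}\right)\|\boldsymbol\Theta(\mathbf s)\|^{\alpha}\right],$$ where $d(-r^{-\alpha})=\alpha r^{-\alpha-1}\,dr$, both right-hand sides are absolutely convergent, and the integrand on the right of the second identity is $0$ where $\boldsymbol\Theta(\mathbf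 s)=\mathbf 0$. -/

import Mathlib

open MeasureTheory ProbabilityTheory Filter Topology Set
open scoped ENNReal BoundedContinuousFunction CompactlySupported

namespace RegVar

/-- `V` is regularly varying at infinity with exponent `ρ`: measurable, eventually positive, and
`V (u x) / V x → u ^ ρ` as `x → ∞`, for every `u > 0`. -/
def RegularlyVaryingFunction (V : ℝ → ℝ) (ρ : ℝ) : Prop :=
  Measurable V ∧ (∀ᶠ x in atTop, 0 < V x) ∧
    ∀ u : ℝ, 0 < u → Tendsto (fun x => V (u * x) / V x) atTop (𝓝 (u ^ ρ))

/-- The punctured compactified space `[-∞, ∞]^ι \ {0}`. -/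
abbrev Punctured (ι : Type*) : Type _ := {z : ι → EReal // z ≠ 0}

/-- Vague convergence as `x → ∞`: convergence of the integrals of all continuous functions with
compact support. -/
def VagueTendsto {S : Type*} [TopologicalSpace S] [MeasurableSpace S]
    (ν : ℝ → Measure S) (μ : Measure S) : Prop :=
  ∀ f : C_c(S, ℝ), Tendsto (fun x => ∫ z, f z ∂(ν x)) atTop (𝓝 (∫ z, f z ∂μ))

/-- The restriction to `[-∞, ∞]^ι \ {0}` of the law of `x⁻¹ Z`. -/
noncomputable def scaledLaw {Ω ι : Type*} [MeasurableSpace Ω] (P : Measure Ω)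
    (Z : Ω → ι → ℝ) (x : ℝ) : Measure (Punctured ι) :=
  (P.map (fun ω (i : ι) => ((x⁻¹ * Z ω i : ℝ) : EReal))).comap Subtype.val

/-- The random vector `Z` in `ℝ^ι` is (multivariate) regularly varying with index `α`: for some
function `V`, regularly varying with exponent `-α`, and some nonzero Radon measure `μ` on
`[-∞, ∞]^ι \ {0}` that does not charge the infinite points, `P (x⁻¹ Z ∈ ·) / V x → μ` vaguely. -/
def RegularlyVaryingVector {Ω ι : Type*} [MeasurableSpace Ω] (P : Measure Ω)
    (Z : Ω → ι → ℝ) (α : ℝ) : Prop :=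
  ∃ (V : ℝ → ℝ) (μ : Measure (Punctured ι)),
    RegularlyVaryingFunction V (-α) ∧ μ.Regular ∧ μ ≠ 0 ∧
    μ {z | ∃ i, z.1 i = ⊤ ∨ z.1 i = ⊥} = 0 ∧
    VagueTendsto (fun x => ENNReal.ofReal (V x)⁻¹ • scaledLaw P Z x) μ

/-- The `ℝ^d`-valued random field `X`, indexed by `ℤ^k`, is jointly regularly varying with
index `α`: for all finitely many (at least one) points `t` of `ℤ^k`, the vector of the `X t` is
regularly varying with index `α`. -/
def JointlyRegularlyVarying {Ω : Type*} [MeasurableSpace Ω] {k d : ℕ} (P : Measure Ω)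
    (X : (Fin k → ℤ) → Ω → (Fin d → ℝ)) (α : ℝ) : Prop :=
  ∀ I : Finset (Fin k → ℤ), I.Nonempty →
    RegularlyVaryingVector P (fun ω (p : I × Fin d) => X p.1 ω p.2) α

/-- (Strict) stationarity: all shifts of the field have the same law. -/
def Stationary {Ω : Type*} [MeasurableSpace Ω] {k d : ℕ} (P : Measure Ω)
    (X : (Fin k → ℤ) → Ω → (Fin d → ℝ)) : Prop :=
  ∀ s : Fin k → ℤ, IdentDistrib (fun ω t => X (t + s) ω) (fun ω t => X t ω) P P

/-- `Y` (on its own probability space) is the tail field of `X`, with respect to the norm `N`: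
the finite-dimensional distributions of `x⁻¹ X` conditionally on `N (X 0) > x` converge weakly to
those of `Y` as `x → ∞`. -/
def IsTailField {Ω Ω' : Type*} [MeasurableSpace Ω] [MeasurableSpace Ω'] {k d : ℕ}
    (N : Seminorm ℝ (Fin d → ℝ)) (P : Measure Ω) (X : (Fin k → ℤ) → Ω → (Fin d → ℝ))
    (P' : Measure Ω') (Y : (Fin k → ℤ) → Ω' → (Fin d → ℝ)) : Prop :=
  ∀ (I : Finset (Fin k → ℤ)) (f : (I → Fin d → ℝ) →ᵇ ℝ),
    Tendsto (fun x : ℝ => ∫ ω, f (fun t => x⁻¹ • X t ω) ∂(cond P {ω | x < N (X 0 ω)})) atTop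
      (𝓝 (∫ ω, f (fun t => Y t ω) ∂P'))

/-- The spectral field `Θ t = Y t / N (Y 0)` of the tail field `Y`. -/
noncomputable def spectralField {Ω' : Type*} {k d : ℕ} (N : Seminorm ℝ (Fin d → ℝ))
    (Y : (Fin k → ℤ) → Ω' → (Fin d → ℝ)) : (Fin k → ℤ) → Ω' → (Fin d → ℝ) :=
  fun t ω => (N (Y 0 ω))⁻¹ • Y t ω

/-- The measure `d(-r^{-α}) = α r^{-α-1} dr` on `(0, ∞)`. -/
noncomputable def powerMeasure (α : ℝ) : Measure ℝ :=
  (volume.restrict (Ioi 0)).withDensity (fun r => ENNReal.ofReal (α * r ^ (-α - 1)))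

end RegVar

/-! Write R(x) for the expectation of `ramp (N (X 0) / x)`, a smoothed tail of the norm at the
origin. Vague convergence applied to this continuous test function shows that R is asymptotic to a
positive multiple of V, so R(ux)/R(x) → u^(-α). The definition of the tail field shows that R(x)/P(N
(X 0) > x) has a limit, which is positive. Hence the true tail satisfies P(N (X 0) > ux)/P(N (X 0) >
x) → u^(-α) (`tendsto_tail_div`), with no discussion of which sets have null boundary for the limit
measure. Letting u decrease to 1 gives N (Y 0) > 1 almost surely.

The core is a change of threshold. Let f vanish where N (y s) ≤ 1 and where N (y 0) ≤ ε. By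
stationarity E f(X(· - s)/x) = E f(X/x). Divided by P(N (X 0) > x), the left side tends to E f(Y(· -
s)); the right side, normalized at level εx instead of x, tends to ε^(-α) E f(εY). This is
`integral_shift_tailField`; `restrict_map_shift_tailField` turns it into an equality of measures.

For s = 0 it says that N (Y 0) is Pareto and independent of Θ, so ε^(-α) times the law of εY is the
tail measure, the image of d(-r^(-α)) ⊗ P' under rΘ, restricted to N (y 0) > ε. For general s,
letting ε → 0 identifies the law of Y(· - s) on y 0 ≠ 0 with the tail measure on N (y s) > 1. The
first identity is this fact and Fubini. The second is the first for a function invariant under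
positive scaling, with the r-integral carried out. -/

namespace RegVar

/-! ### Cut-off functions, norms on finite-dimensional space, truncation -/

/-- The continuous function on `ℝ` that is `0` up to `1`, then increases linearly to `1` at `2`,
and is constant from there on. -/
noncomputable def ramp (r : ℝ) : ℝ := max 0 (min 1 (r - 1))

lemma continuous_ramp : Continuous ramp := by unfold ramp; fun_prop

lemma ramp_nonneg (r : ℝ) : 0 ≤ ramp r := le_max_left _ _

lemma ramp_le_one (r : ℝ) : ramp r ≤ 1 := max_le zero_le_one (min_le_left _ _)

lemma ramp_of_le_one {r : ℝ} (h : r ≤ 1) : ramp r = 0 :=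
  max_eq_left ((min_le_right _ _).trans (by linarith))

lemma ramp_of_two_le {r : ℝ} (h : 2 ≤ r) : ramp r = 1 := by
  unfold ramp; rw [min_eq_left (by linarith), max_eq_right zero_le_one]

lemma ramp_pos_iff {r : ℝ} : 0 < ramp r ↔ 1 < r := by
  constructor
  · intro h
    by_contra! h1
    exact h.ne' (ramp_of_le_one h1)
  · intro h
    exact lt_max_of_lt_right (lt_min one_pos (by linarith))

section Seminorm

variable {ι : Type*} [Fintype ι]

lemma continuous_seminorm (N : Seminorm ℝ (ι → ℝ)) : Continuous N :=
  continuousOn_univ.1 (N.convexOn.continuousOn isOpen_univ)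

lemma exists_mul_norm_le_seminorm (N : Seminorm ℝ (ι → ℝ)) (hN : ∀ v, N v = 0 → v = 0) :
    ∃ c > 0, ∀ v, c * ‖v‖ ≤ N v := by
  -- The unit sphere is empty in dimension zero, where there is no minimum of `N` to take as the
  -- constant.
  rcases (Metric.sphere (0 : ι → ℝ) 1).eq_empty_or_nonempty with he | hne
  · refine ⟨1, one_pos, fun v => ?_⟩
    have : v = 0 := by
      by_contra hv
      have : ‖v‖⁻¹ • v ∈ Metric.sphere (0 : ι → ℝ) 1 := by
        simp [norm_smul, inv_mul_cancel₀ (norm_ne_zero_iff.2 hv)]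
      simp [he] at this
    simp [this]
  · obtain ⟨v₀, hv₀, hmin⟩ := (isCompact_sphere (0 : ι → ℝ) 1).exists_isMinOn hne
      (continuous_seminorm N).continuousOn
    have hv₀' : v₀ ≠ 0 := by rintro rfl; simp at hv₀
    refine ⟨N v₀, lt_of_le_of_ne (apply_nonneg N _) fun h => hv₀' (hN _ h.symm), fun v => ?_⟩
    rcases eq_or_ne v 0 with rfl | hv
    · simp
    have hv1 : 0 < ‖v‖ := norm_pos_iff.2 hv
    have : ‖v‖⁻¹ • v ∈ Metric.sphere (0 : ι → ℝ) 1 := by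
      simp [norm_smul, inv_mul_cancel₀ hv1.ne']
    have h2 : N v₀ ≤ N (‖v‖⁻¹ • v) := hmin this
    rw [map_smul_eq_mul, norm_inv, norm_norm, inv_mul_eq_div, le_div_iff₀ hv1] at h2
    exact h2

end Seminorm

/-- Truncation of an extended real number to `[-M, M]`. -/
noncomputable def clamp (M : ℝ) (t : EReal) : ℝ := (max ((-M : ℝ) : EReal) (min t (M : ℝ))).toReal

lemma continuous_clamp (M : ℝ) : Continuous (clamp M) := by
  refine EReal.continuousOn_toReal.comp_continuous (by fun_prop) fun t => ?_
  simp only [mem_compl_iff, mem_insert_iff, mem_singleton_iff, not_or]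
  constructor
  · exact (lt_of_lt_of_le (EReal.bot_lt_coe _) (le_max_left _ _)).ne'
  · exact (max_lt (EReal.coe_lt_top _) ((min_le_right _ _).trans_lt (EReal.coe_lt_top _))).ne

lemma clamp_coe (M t : ℝ) : clamp M t = max (-M) (min t M) := by
  have hm : Monotone ((↑) : ℝ → EReal) := EReal.coe_strictMono.monotone
  rw [clamp, ← hm.map_min, ← hm.map_max, EReal.toReal_coe]

lemma clamp_eq_zero {M : ℝ} (hM : 0 < M) {t : EReal} (h : clamp M t = 0) : t = 0 := by
  induction t using EReal.rec with
  | bot => simp [clamp] at h; exact absurd h hM.ne'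
  | top =>
    rw [clamp, min_eq_right le_top, max_eq_right (by exact_mod_cast by linarith),
      EReal.toReal_coe] at h
    exact absurd h hM.ne'
  | coe t =>
    rw [clamp_coe] at h
    norm_cast
    rcases le_total t M with h1 | h1
    · rw [min_eq_left h1] at h
      rcases le_total (-M) t with h2 | h2
      · rwa [max_eq_right h2] at h
      · rw [max_eq_left h2] at h; linarith
    · rw [min_eq_right h1, max_eq_right (by linarith)] at h; linarith

/-! ### From vague convergence to a smoothed regularly varying tail -/

section Vague

variable {ι : Type*} [Fintype ι]

/-- A norm makes no sense at infinite coordinates, so test functions must be truncated. Truncation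
at 2/c is harmless: a coordinate of size at least 2/c forces N ≥ 2 ≥ 2δ, where the ramp has already
reached 1. -/
lemma ramp_seminorm_clamp {N : Seminorm ℝ (ι → ℝ)} {c : ℝ} (hc : 0 < c)
    (hcN : ∀ v, c * ‖v‖ ≤ N v) {δ : ℝ} (hδ : 0 < δ) (hδ1 : δ ≤ 1) (z : ι → ℝ) :
    ramp (N (fun i => clamp (2 / c) (z i : EReal)) / δ) = ramp (N z / δ) := by
  simp only [clamp_coe]
  have hM : 0 < 2 / c := by positivity
  have key : ∀ v : ι → ℝ, (∃ i, 2 / c ≤ |v i|) → ramp (N v / δ) = 1 := by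
    rintro v ⟨i, hi⟩
    apply ramp_of_two_le
    rw [le_div_iff₀ hδ]
    have h1 : 2 / c ≤ ‖v‖ := hi.trans (norm_le_pi_norm v i)
    have h2 := hcN v
    rw [div_le_iff₀ hc] at h1
    nlinarith
  by_cases h : ∃ i, 2 / c ≤ |z i|
  · rw [key z h]
    obtain ⟨i, hi⟩ := h
    refine key _ ⟨i, ?_⟩
    rcases le_abs.1 hi with h1 | h1
    · rw [min_eq_right h1, max_eq_right (by linarith), abs_of_pos hM]
    · rw [min_eq_left (by linarith), max_eq_left (by linarith), abs_neg, abs_of_pos hM]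
  · push Not at h
    congr 3
    ext i
    have := abs_lt.1 (h i)
    rw [min_eq_left this.2.le, max_eq_right this.1.le]

/-- `ramp (N z / δ)` on `[-∞, ∞]^ι \ {0}`, truncated near the infinite points. -/
noncomputable def rampTest (N : Seminorm ℝ (ι → ℝ)) {M δ : ℝ} (hM : 0 < M) (hδ : 0 < δ) :
    C_c(Punctured ι, ℝ) where
  toFun z := ramp (N (fun i => clamp M (z.1 i)) / δ)
  continuous_toFun := by
    refine continuous_ramp.comp (((continuous_seminorm N).comp (continuous_pi fun i => ?_)).div_const
      δ)
    exact (continuous_clamp M).comp ((continuous_apply i).comp continuous_subtype_val)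
  -- The set where the truncated norm is at least δ is closed in the compact cube `[-∞, ∞]^ι` and
  -- misses the origin, so it is compact in the punctured space.
  hasCompactSupport' := by
    let F : (ι → EReal) → ℝ := fun z => N (fun i => clamp M (z i))
    have hF : Continuous F := by
      have h3 := continuous_clamp M
      exact (continuous_seminorm N).comp (by fun_prop)
    have hK : IsCompact (F ⁻¹' Ici δ) := (isClosed_Ici.preimage hF).isCompact
    have h0 : F 0 = 0 := by
      have h00 : clamp M 0 = 0 := by
        have := clamp_coe M 0
        rwa [min_eq_left hM.le, max_eq_right (by linarith)] at this
      have : (fun i : ι => clamp M ((0 : ι → EReal) i)) = 0 := funext fun _ => h00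
      simp only [F, this, map_zero]
    have hK' : IsCompact ((Subtype.val : Punctured ι → _) ⁻¹' (F ⁻¹' Ici δ)) := by
      refine Topology.IsInducing.subtypeVal.isCompact_preimage' hK fun z hz => ?_
      refine ⟨⟨z, ?_⟩, rfl⟩
      rintro rfl
      have hz : δ ≤ F 0 := hz
      linarith
    refine HasCompactSupport.intro hK' fun z hz => ramp_of_le_one ?_
    rw [div_le_one hδ]
    exact (not_le.1 hz).le

variable {Ω : Type*} [MeasurableSpace Ω] {P : Measure Ω} {Z : Ω → ι → ℝ}

lemma integral_rampTest_scaledLaw (hZ : Measurable Z) {N : Seminorm ℝ (ι → ℝ)}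
    {c : ℝ} (hc : 0 < c) (hcN : ∀ v, c * ‖v‖ ≤ N v) {δ : ℝ} (hδ : 0 < δ) (hδ1 : δ ≤ 1)
    {x v : ℝ} (hx : 0 < x) (hv : 0 < v) :
    ∫ z, rampTest N (div_pos two_pos hc) hδ z ∂(ENNReal.ofReal v⁻¹ • scaledLaw P Z x) =
      (∫ ω, ramp ((δ * x)⁻¹ * N (Z ω)) ∂P) / v := by
  have hM : 0 < 2 / c := by positivity
  let F : (ι → EReal) → ℝ := fun z => ramp (N (fun i => clamp (2 / c) (z i)) / δ)
  have hF : Continuous F := by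
    have h3 := continuous_clamp (2 / c)
    exact continuous_ramp.comp
      (((continuous_seminorm N).comp (by fun_prop)).div_const δ)
  have hZx : Measurable (fun ω (i : ι) => ((x⁻¹ * Z ω i : ℝ) : EReal)) := by fun_prop
  have hs : MeasurableSet {z : ι → EReal | z ≠ 0} := (measurableSet_singleton 0).compl
  have h1 : ∫ z, rampTest N hM hδ z ∂(scaledLaw P Z x) =
      ∫ z in {z : ι → EReal | z ≠ 0}, F z ∂(P.map fun ω (i : ι) => ((x⁻¹ * Z ω i : ℝ) : EReal)) :=
    integral_subtype_comap hs F
  -- The test function vanishes at the origin, so removing that point from the scaled law loses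
  -- nothing.
  have h0 : ∀ z ∉ {z : ι → EReal | z ≠ 0}, F z = 0 := by
    intro z hz
    have hz : z = 0 := by simpa using hz
    have := ramp_seminorm_clamp hc hcN hδ hδ1 0
    simp only [Pi.zero_apply, map_zero, zero_div, EReal.coe_zero] at this
    rw [ramp_of_le_one zero_le_one] at this
    rw [hz]; exact this
  rw [integral_smul_measure, h1, setIntegral_eq_integral_of_forall_compl_eq_zero h0,
    integral_map hZx.aemeasurable hF.aestronglyMeasurable,
    ENNReal.toReal_ofReal (inv_nonneg.2 hv.le), smul_eq_mul, inv_mul_eq_div]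
  congr 2
  ext ω
  change ramp _ = _
  rw [ramp_seminorm_clamp hc hcN hδ hδ1 (fun i => x⁻¹ * Z ω i)]
  have : (fun i => x⁻¹ * Z ω i) = x⁻¹ • Z ω := rfl
  rw [this, map_smul_eq_mul, Real.norm_of_nonneg (inv_nonneg.2 hx.le)]
  congr 1
  field_simp

/-- A norm of a regularly varying vector, tested against `ramp`, is asymptotically proportional
to a regularly varying function. -/
lemma RegularlyVaryingVector.exists_tendsto_integral_ramp {α : ℝ}
    (h : RegularlyVaryingVector P Z α) (hZ : Measurable Z)
    (N : Seminorm ℝ (ι → ℝ)) (hN : ∀ v, N v = 0 → v = 0) :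
    ∃ (V : ℝ → ℝ) (c : ℝ), RegularlyVaryingFunction V (-α) ∧ 0 < c ∧
      Tendsto (fun x => (∫ ω, ramp (x⁻¹ * N (Z ω)) ∂P) / V x) atTop (𝓝 c) := by
  obtain ⟨V, μ, hV, hμr, hμ0, -, hlim⟩ := h
  obtain ⟨c, hc, hcN⟩ := exists_mul_norm_le_seminorm N hN
  have hM : 0 < 2 / c := by positivity
  have hconv : ∀ {δ : ℝ} (hδ : 0 < δ), δ ≤ 1 →
      Tendsto (fun x => (∫ ω, ramp ((δ * x)⁻¹ * N (Z ω)) ∂P) / V x) atTop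
        (𝓝 (∫ z, rampTest N hM hδ z ∂μ)) := by
    intro δ hδ hδ1
    refine (hlim (rampTest N hM hδ)).congr' ?_
    filter_upwards [hV.2.1, eventually_gt_atTop 0] with x hVx hx
    exact integral_rampTest_scaledLaw hZ hc hcN hδ hδ1 hx hVx
  have hconv1 := hconv one_pos le_rfl
  simp only [one_mul] at hconv1
  refine ⟨V, _, hV, ?_, hconv1⟩
  have hnn : ∀ {δ : ℝ} (hδ : 0 < δ), 0 ≤ ∫ z, rampTest N hM hδ z ∂μ :=
    fun hδ => integral_nonneg fun z => ramp_nonneg _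
  -- If the limit were 0 at scale 1, regular variation of V would make it 0 at every scale δ ≤ 1.
  -- Taking δ = 1/(n+1) for all n, the truncated norm would vanish almost everywhere; as it vanishes
  -- only at the excluded origin, μ would be 0.
  refine lt_of_le_of_ne (hnn one_pos) fun h0 => hμ0 ?_
  rw [← h0] at hconv1
  have hzero : ∀ {δ : ℝ} (hδ : 0 < δ), δ ≤ 1 → ∫ z, rampTest N hM hδ z ∂μ = 0 := by
    intro δ hδ hδ1
    have hδt : Tendsto (fun x => δ * x) atTop atTop := tendsto_id.const_mul_atTop hδ
    have h1 := (hconv1.comp hδt).mul (hV.2.2 δ hδ)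
    rw [zero_mul] at h1
    refine tendsto_nhds_unique (hconv hδ hδ1) (h1.congr' ?_)
    filter_upwards [hδt.eventually hV.2.1] with x hx
    simp only [Function.comp]
    field_simp
  have hae : ∀ n : ℕ, ∀ᵐ z ∂μ, N (fun i => clamp (2 / c) (z.1 i)) ≤ 1 / (n + 1) := by
    intro n
    have hδ : (0 : ℝ) < 1 / (n + 1) := by positivity
    have hδ1 : (1 : ℝ) / (n + 1) ≤ 1 := by
      rw [div_le_one (by positivity)]
      have : (0 : ℝ) ≤ n := n.cast_nonneg
      linarith
    have := (integral_eq_zero_iff_of_nonneg (fun z => ramp_nonneg _)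
      ((rampTest N hM hδ).continuous.integrable_of_hasCompactSupport
        (rampTest N hM hδ).hasCompactSupport)).1 (hzero hδ hδ1)
    filter_upwards [this] with z hz
    by_contra! hlt
    have : 0 < rampTest N hM hδ z := ramp_pos_iff.2 ((one_lt_div hδ).2 hlt)
    exact this.ne' hz
  rw [← Measure.measure_univ_eq_zero, ← compl_empty]
  refine measure_mono_null (t := _) ?_ (ae_iff.1 (ae_all_iff.2 hae))
  rintro z - hz
  apply z.2
  have hz0 : N (fun i => clamp (2 / c) (z.1 i)) = 0 :=
    le_antisymm (ge_of_tendsto' tendsto_one_div_add_atTop_nhds_zero_nat hz) (apply_nonneg N _)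
  ext i
  exact clamp_eq_zero hM (congrFun (hN _ hz0) i)

lemma RegularlyVaryingVector.eventually_integral_ramp_pos {α : ℝ}
    (h : RegularlyVaryingVector P Z α) (hZ : Measurable Z)
    (N : Seminorm ℝ (ι → ℝ)) (hN : ∀ v, N v = 0 → v = 0) :
    ∀ᶠ x in atTop, 0 < ∫ ω, ramp (x⁻¹ * N (Z ω)) ∂P := by
  obtain ⟨V, c, hV, hc, hlim⟩ := h.exists_tendsto_integral_ramp hZ N hN
  filter_upwards [hlim.eventually (lt_mem_nhds hc), hV.2.1] with x hx hVx
  exact (div_pos_iff_of_pos_right hVx).1 hx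

lemma RegularlyVaryingVector.tendsto_integral_ramp_div {α : ℝ}
    (h : RegularlyVaryingVector P Z α) (hZ : Measurable Z)
    (N : Seminorm ℝ (ι → ℝ)) (hN : ∀ v, N v = 0 → v = 0) {u : ℝ} (hu : 0 < u) :
    Tendsto (fun x => (∫ ω, ramp ((u * x)⁻¹ * N (Z ω)) ∂P) / ∫ ω, ramp (x⁻¹ * N (Z ω)) ∂P)
      atTop (𝓝 (u ^ (-α))) := by
  obtain ⟨V, c, hV, hc, hlim⟩ := h.exists_tendsto_integral_ramp hZ N hN
  have hut : Tendsto (fun x => u * x) atTop atTop := tendsto_id.const_mul_atTop hu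
  have h1 := ((hlim.comp hut).mul (hV.2.2 u hu)).mul (hlim.inv₀ hc.ne')
  have : c * u ^ (-α) * c⁻¹ = u ^ (-α) := by field_simp
  rw [this] at h1
  refine h1.congr' ?_
  filter_upwards [hut.eventually hV.2.1, hV.2.1, h.eventually_integral_ramp_pos hZ N hN]
    with x h1 h2 h3
  simp only [Function.comp]
  field_simp

end Vague

/-- Since G already vanishes off A, conditioning is only a division by the mass of A. If that mass
is 0 or infinite, both sides are 0 by convention. -/
lemma integral_cond_of_forall_notMem {Ω : Type*} [MeasurableSpace Ω] (P : Measure Ω)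
    {A : Set Ω} {G : Ω → ℝ} (hG : ∀ ω ∉ A, G ω = 0) :
    ∫ ω, G ω ∂(cond P A) = (∫ ω, G ω ∂P) / P.real A := by
  rw [ProbabilityTheory.cond, integral_smul_measure, setIntegral_eq_integral_of_forall_compl_eq_zero hG,
    ENNReal.toReal_inv, smul_eq_mul, inv_mul_eq_div, Measure.real]

/-! ### Tail of the norm at the origin, and the bound N (Y 0) > 1 -/

section TailField

variable {Ω Ω' : Type*} [MeasurableSpace Ω] [MeasurableSpace Ω'] {k d : ℕ}
  {N : Seminorm ℝ (Fin d → ℝ)} {P : Measure Ω} {P' : Measure Ω'} {α : ℝ}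
  {X : (Fin k → ℤ) → Ω → (Fin d → ℝ)} {Y : (Fin k → ℤ) → Ω' → (Fin d → ℝ)}

lemma JointlyRegularlyVarying.ramp_at_zero (hXrv : JointlyRegularlyVarying P X α)
    (hN : ∀ v, N v = 0 → v = 0) (hXm : ∀ t, Measurable (X t)) :
    (∀ᶠ x in atTop, 0 < ∫ ω, ramp (x⁻¹ * N (X 0 ω)) ∂P) ∧
    ∀ u : ℝ, 0 < u →
      Tendsto (fun x => (∫ ω, ramp ((u * x)⁻¹ * N (X 0 ω)) ∂P) / ∫ ω, ramp (x⁻¹ * N (X 0 ω)) ∂P)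
        atTop (𝓝 (u ^ (-α))) := by
  let I : Finset (Fin k → ℤ) := {0}
  have h0 : (0 : Fin k → ℤ) ∈ I := Finset.mem_singleton_self 0
  have h := hXrv I ⟨0, h0⟩
  have hZ : Measurable (fun ω (p : I × Fin d) => X p.1 ω p.2) :=
    measurable_pi_lambda _ fun p => (measurable_pi_apply p.2).comp (hXm p.1)
  -- One site suffices: `N` is transported along the identification of `{0} × Fin d` with `Fin d`.
  let N' : Seminorm ℝ (I × Fin d → ℝ) :=
    N.comp (LinearMap.funLeft ℝ ℝ fun i : Fin d => ((⟨0, h0⟩ : I), i))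
  have hN' : ∀ v, N' v = 0 → v = 0 := by
    intro v hv
    have := hN _ hv
    ext ⟨⟨t, ht⟩, i⟩
    obtain rfl := Finset.mem_singleton.1 ht
    exact congrFun this i
  exact ⟨h.eventually_integral_ramp_pos hZ N' hN',
    fun u hu => h.tendsto_integral_ramp_div hZ N' hN' hu⟩

lemma measurable_norm_field (hXm : ∀ t, Measurable (X t)) (t : Fin k → ℤ) :
    Measurable fun ω => N (X t ω) :=
  (continuous_seminorm N).measurable.comp (hXm t)

lemma integrable_ramp [IsFiniteMeasure P] {G : Ω → ℝ} (hG : Measurable G) :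
    Integrable (fun ω => ramp (G ω)) P :=
  Integrable.of_bound (continuous_ramp.measurable.comp hG).aestronglyMeasurable 1
    (ae_of_all _ fun ω => by
      rw [Real.norm_of_nonneg (ramp_nonneg _)]; exact ramp_le_one _)

/-- With `real_le_integral_ramp`, this is the sandwich ramp(r) ≤ 1(r > 1) ≤ ramp(2r) between the
smoothed and the true tail. -/
lemma integral_ramp_le_real [IsFiniteMeasure P] (hXm : ∀ t, Measurable (X t)) {x : ℝ} (hx : 0 < x) :
    ∫ ω, ramp (x⁻¹ * N (X 0 ω)) ∂P ≤ P.real {ω | x < N (X 0 ω)} := by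
  have hm : MeasurableSet {ω | x < N (X 0 ω)} :=
    measurableSet_lt measurable_const (measurable_norm_field hXm 0)
  rw [← integral_indicator_one hm]
  refine integral_mono (integrable_ramp ((measurable_norm_field hXm 0).const_mul _))
    ((integrable_const 1).indicator hm) fun ω => ?_
  by_cases h : x < N (X 0 ω)
  · simpa [indicator, h] using ramp_le_one _
  · simp only [indicator, mem_ofPred_eq, h, if_false]
    refine (ramp_of_le_one ?_).le
    rw [inv_mul_le_one₀ hx]
    exact not_lt.1 h

lemma real_le_integral_ramp [IsFiniteMeasure P] (hXm : ∀ t, Measurable (X t)) {x : ℝ} (hx : 0 < x) :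
    P.real {ω | x < N (X 0 ω)} ≤ ∫ ω, ramp ((2⁻¹ * x)⁻¹ * N (X 0 ω)) ∂P := by
  have hm : MeasurableSet {ω | x < N (X 0 ω)} :=
    measurableSet_lt measurable_const (measurable_norm_field hXm 0)
  rw [← integral_indicator_one hm]
  refine integral_mono ((integrable_const 1).indicator hm)
    (integrable_ramp ((measurable_norm_field hXm 0).const_mul _)) fun ω => ?_
  by_cases h : x < N (X 0 ω)
  · simp only [indicator, mem_ofPred_eq, h, if_true, Pi.one_apply]
    refine (ramp_of_two_le ?_).ge
    rw [inv_mul_eq_div, le_div_iff₀ (by positivity)]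
    linarith
  · simpa [indicator, h] using ramp_nonneg _

/-- Convergence to the tail field for functions of the field that vanish where the
conditioning event fails. -/
lemma IsTailField.tendsto_div (hY : IsTailField N P X P' Y) (I : Finset (Fin k → ℤ))
    (f : (I → Fin d → ℝ) →ᵇ ℝ)
    (hf : ∀ y : (Fin k → ℤ) → Fin d → ℝ, N (y 0) ≤ 1 → f (fun t => y t) = 0) :
    Tendsto (fun x : ℝ => (∫ ω, f (fun t => x⁻¹ • X t ω) ∂P) / P.real {ω | x < N (X 0 ω)}) atTop
      (𝓝 (∫ ω, f (fun t => Y t ω) ∂P')) := by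
  refine (hY I f).congr' ?_
  filter_upwards [eventually_gt_atTop 0] with x hx
  refine integral_cond_of_forall_notMem P fun ω hω => ?_
  refine hf (fun t => x⁻¹ • X t ω) ?_
  rw [map_smul_eq_mul, Real.norm_of_nonneg (inv_nonneg.2 hx.le), inv_mul_le_one₀ hx]
  exact not_lt.1 hω

lemma IsTailField.tendsto_ramp_div (hY : IsTailField N P X P' Y) :
    Tendsto (fun x : ℝ => (∫ ω, ramp (x⁻¹ * N (X 0 ω)) ∂P) / P.real {ω | x < N (X 0 ω)}) atTop
      (𝓝 (∫ ω, ramp (N (Y 0 ω)) ∂P')) := by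
  let I : Finset (Fin k → ℤ) := {0}
  have h0 : (0 : Fin k → ℤ) ∈ I := Finset.mem_singleton_self 0
  let f : (I → Fin d → ℝ) →ᵇ ℝ := BoundedContinuousFunction.ofNormedAddCommGroup
    (fun z => ramp (N (z ⟨0, h0⟩)))
    (continuous_ramp.comp ((continuous_seminorm N).comp (continuous_apply _))) 1
    (fun z => by rw [Real.norm_of_nonneg (ramp_nonneg _)]; exact ramp_le_one _)
  refine (hY.tendsto_div I f fun y hy => ramp_of_le_one hy).congr' ?_
  filter_upwards [eventually_gt_atTop 0] with x hx
  congr 2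
  ext ω
  change ramp (N (x⁻¹ • X 0 ω)) = _
  rw [map_smul_eq_mul, Real.norm_of_nonneg (inv_nonneg.2 hx.le)]

lemma eventually_tail_pos [IsFiniteMeasure P] (hN : ∀ v, N v = 0 → v = 0)
    (hXm : ∀ t, Measurable (X t)) (hXrv : JointlyRegularlyVarying P X α) :
    ∀ᶠ x in atTop, 0 < P.real {ω | x < N (X 0 ω)} := by
  filter_upwards [(hXrv.ramp_at_zero hN hXm).1, eventually_gt_atTop 0] with x h1 hx
  exact h1.trans_le (integral_ramp_le_real hXm hx)

/-- The sandwich gives R(x)/P(N (X 0) > x) ≥ R(x)/R(x/2) → 2^(-α), which bounds the limit away from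
0. Positivity is what allows dividing by it to recover the true tail. -/
lemma integral_ramp_tailField_pos [IsFiniteMeasure P] (hN : ∀ v, N v = 0 → v = 0)
    (hXm : ∀ t, Measurable (X t)) (hXrv : JointlyRegularlyVarying P X α)
    (hY : IsTailField N P X P' Y) : 0 < ∫ ω, ramp (N (Y 0 ω)) ∂P' := by
  obtain ⟨hpos, hr⟩ := hXrv.ramp_at_zero hN hXm
  have h2 := (hr 2⁻¹ (by norm_num)).inv₀ (Real.rpow_pos_of_pos (by norm_num) _).ne'
  refine lt_of_lt_of_le ?_ (le_of_tendsto_of_tendsto h2 hY.tendsto_ramp_div ?_)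
  · exact inv_pos.2 (Real.rpow_pos_of_pos (by norm_num) _)
  · filter_upwards [hpos, eventually_tail_pos hN hXm hXrv, eventually_gt_atTop 0] with x h1 h3 hx
    rw [inv_div]
    exact div_le_div_of_nonneg_left h1.le h3 (real_le_integral_ramp hXm hx)

/-- The norm of the field at the origin has a regularly varying tail. -/
lemma tendsto_tail_div [IsFiniteMeasure P] (hN : ∀ v, N v = 0 → v = 0)
    (hXm : ∀ t, Measurable (X t)) (hXrv : JointlyRegularlyVarying P X α)
    (hY : IsTailField N P X P' Y) {u : ℝ} (hu : 0 < u) :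
    Tendsto (fun x => P.real {ω | u * x < N (X 0 ω)} / P.real {ω | x < N (X 0 ω)}) atTop
      (𝓝 (u ^ (-α))) := by
  obtain ⟨hpos, hr⟩ := hXrv.ramp_at_zero hN hXm
  have hc := integral_ramp_tailField_pos hN hXm hXrv hY
  have hut : Tendsto (fun x => u * x) atTop atTop := tendsto_id.const_mul_atTop hu
  have h1 := (((hY.tendsto_ramp_div.comp hut).inv₀ hc.ne').mul (hr u hu)).mul hY.tendsto_ramp_div
  have : (∫ ω, ramp (N (Y 0 ω)) ∂P')⁻¹ * u ^ (-α) * (∫ ω, ramp (N (Y 0 ω)) ∂P') = u ^ (-α) := by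
    field_simp
  rw [this] at h1
  refine h1.congr' ?_
  filter_upwards [hpos, hut.eventually hpos, eventually_tail_pos hN hXm hXrv,
    hut.eventually (eventually_tail_pos hN hXm hXrv)] with x h1 h2 h3 h4
  simp only [Function.comp]
  generalize (∫ ω, ramp (x⁻¹ * N (X 0 ω)) ∂P) = a at h1 ⊢
  generalize (∫ ω, ramp ((u * x)⁻¹ * N (X 0 ω)) ∂P) = b at h2 ⊢
  field_simp

/-- The tail field exceeds `1` in norm at the origin. -/
lemma ae_one_lt_tailField [IsFiniteMeasure P] [IsProbabilityMeasure P']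
    (hN : ∀ v, N v = 0 → v = 0)
    (hXm : ∀ t, Measurable (X t)) (hXrv : JointlyRegularlyVarying P X α)
    (hYm : ∀ t, Measurable (Y t)) (hY : IsTailField N P X P' Y) :
    ∀ᵐ ω ∂P', 1 < N (Y 0 ω) := by
  have hm : MeasurableSet {ω | 1 < N (Y 0 ω)} :=
    measurableSet_lt measurable_const (measurable_norm_field hYm 0)
  let I : Finset (Fin k → ℤ) := {0}
  have h0 : (0 : Fin k → ℤ) ∈ I := Finset.mem_singleton_self 0
  have key : ∀ u : ℝ, 1 < u → u ^ (-α) ≤ P'.real {ω | 1 < N (Y 0 ω)} := by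
    intro u hu
    -- A continuous function between 1(r > u) and 1(r > 1): the lower bound meets the tail ratio P(N
    -- (X 0) > ux)/P(N (X 0) > x), the upper one the event N (Y 0) > 1.
    let h : ℝ → ℝ := fun r => max 0 (min 1 ((r - 1) / (u - 1)))
    have hh0 : ∀ r, 0 ≤ h r := fun r => le_max_left _ _
    have hh1 : ∀ r, h r ≤ 1 := fun r => max_le zero_le_one (min_le_left _ _)
    have hle : ∀ r ≤ 1, h r = 0 := fun r hr =>
      max_eq_left ((min_le_right _ _).trans (div_nonpos_of_nonpos_of_nonneg (by linarith)
        (by linarith)))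
    have hge : ∀ r, u < r → h r = 1 := fun r hr => by
      have : 1 ≤ (r - 1) / (u - 1) := by rw [le_div_iff₀ (by linarith)]; linarith
      simp only [h, min_eq_left this, max_eq_right zero_le_one]
    have hcont : Continuous h := by simp only [h]; fun_prop
    let f : (I → Fin d → ℝ) →ᵇ ℝ := BoundedContinuousFunction.ofNormedAddCommGroup
      (fun z => h (N (z ⟨0, h0⟩)))
      (hcont.comp ((continuous_seminorm N).comp (continuous_apply _))) 1
      (fun z => by rw [Real.norm_of_nonneg (hh0 _)]; exact hh1 _)
    have hlim := hY.tendsto_div I f fun y hy => hle _ hy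
    have hN1 : Tendsto _ _ (𝓝 (u ^ (-α))) :=
      tendsto_tail_div hN hXm hXrv hY (zero_lt_one.trans hu)
    refine (le_of_tendsto_of_tendsto hN1 hlim ?_).trans ?_
    · filter_upwards [eventually_gt_atTop 0] with x hx
      refine div_le_div_of_nonneg_right ?_ measureReal_nonneg
      have hmu : MeasurableSet {ω | u * x < N (X 0 ω)} :=
        measurableSet_lt measurable_const (measurable_norm_field hXm 0)
      rw [← integral_indicator_one hmu]
      have hmX : Measurable fun ω => h (N (x⁻¹ • X 0 ω)) :=
        (hcont.comp (continuous_seminorm N)).measurable.comp ((hXm 0).const_smul x⁻¹)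
      have hint : Integrable (fun ω => h (N (x⁻¹ • X 0 ω))) P :=
        Integrable.of_bound hmX.aestronglyMeasurable 1 (ae_of_all _ fun ω => by
          rw [Real.norm_of_nonneg (hh0 _)]; exact hh1 _)
      refine integral_mono ((integrable_const 1).indicator hmu) hint fun ω => ?_
      change _ ≤ h (N (x⁻¹ • X 0 ω))
      by_cases hω : u * x < N (X 0 ω)
      · rw [hge]
        · simp [indicator, hω]
        · rw [map_smul_eq_mul, Real.norm_of_nonneg (inv_nonneg.2 hx.le), inv_mul_eq_div,
            lt_div_iff₀ hx]
          exact hω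
      · simpa [indicator, hω] using hh0 _
    · rw [← integral_indicator_one hm]
      have hmY : Measurable fun ω => h (N (Y 0 ω)) :=
        hcont.measurable.comp (measurable_norm_field hYm 0)
      have hint : Integrable (fun ω => h (N (Y 0 ω))) P' :=
        Integrable.of_bound hmY.aestronglyMeasurable 1 (ae_of_all _ fun ω => by
          rw [Real.norm_of_nonneg (hh0 _)]; exact hh1 _)
      refine integral_mono hint ((integrable_const 1).indicator hm) fun ω => ?_
      change h (N (Y 0 ω)) ≤ _
      by_cases hω : 1 < N (Y 0 ω)
      · simpa [indicator, hω] using hh1 _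
      · rw [hle _ (not_lt.1 hω)]
        simp [indicator, hω]
  -- Let u decrease to 1 in `key`.
  have hone : 1 ≤ P'.real {ω | 1 < N (Y 0 ω)} := by
    have hc : Tendsto (fun u : ℝ => u ^ (-α)) (𝓝[>] 1) (𝓝 (1 ^ (-α))) :=
      (Real.continuousAt_rpow_const 1 (-α) (Or.inl one_ne_zero)).mono_left nhdsWithin_le_nhds
    rw [Real.one_rpow] at hc
    exact le_of_tendsto hc (eventually_nhdsWithin_of_forall fun u hu => key u hu)
  have h1 : P'.real {ω | 1 < N (Y 0 ω)} = 1 := le_antisymm measureReal_le_one hone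
  rw [ae_iff_measure_eq hm.nullMeasurableSet, measure_univ]
  rw [Measure.real, ENNReal.toReal_eq_one_iff] at h1
  exact h1

end TailField

/-! ### Time change for the tail field -/

/-- A finite measure on a space of fields is determined by the integrals of bounded continuous
functions of finitely many values of the field. -/
lemma ext_of_forall_integral_restrict_eq {ι E : Type*} [TopologicalSpace E] [MeasurableSpace E]
    [BorelSpace E] [SecondCountableTopology E] [TopologicalSpace.PseudoMetrizableSpace E]
    {μ ν : Measure (ι → E)} [IsFiniteMeasure μ] [IsFiniteMeasure ν]
    (h : ∀ (I : Finset ι) (f : (I → E) →ᵇ ℝ),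
      ∫ y, f (fun t => y t) ∂μ = ∫ y, f (fun t => y t) ∂ν) : μ = ν := by
  let := TopologicalSpace.pseudoMetrizableSpacePseudoMetric E
  have hmap : ∀ I : Finset ι, μ.map I.restrict = ν.map I.restrict := by
    intro I
    have hm : Measurable (I.restrict : (ι → E) → I → E) := Finset.measurable_restrict I
    have := Measure.isFiniteMeasure_map μ (I.restrict : (ι → E) → I → E)
    have := Measure.isFiniteMeasure_map ν (I.restrict : (ι → E) → I → E)
    refine ext_of_forall_integral_eq_of_IsFiniteMeasure fun f => ?_
    rw [integral_map hm.aemeasurable f.continuous.aestronglyMeasurable,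
      integral_map hm.aemeasurable f.continuous.aestronglyMeasurable]
    exact h I f
  have : ∀ I : Finset ι, IsFiniteMeasure (ν.map (I.restrict : (ι → E) → I → E)) :=
    fun I => Measure.isFiniteMeasure_map ν _
  exact IsProjectiveLimit.unique (P := fun I => ν.map I.restrict) hmap fun I => rfl

section TimeChange

variable {Ω Ω' : Type*} [MeasurableSpace Ω] [MeasurableSpace Ω'] {k d : ℕ}
  {N : Seminorm ℝ (Fin d → ℝ)} {P : Measure Ω} {P' : Measure Ω'} {α : ℝ}
  {X : (Fin k → ℤ) → Ω → (Fin d → ℝ)} {Y : (Fin k → ℤ) → Ω' → (Fin d → ℝ)}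

/-- Time change formula for continuous functions of finitely many values of the tail field. -/
lemma integral_shift_tailField [IsFiniteMeasure P] (hN : ∀ v, N v = 0 → v = 0)
    (hXm : ∀ t, Measurable (X t)) (hXs : Stationary P X) (hXrv : JointlyRegularlyVarying P X α)
    (hY : IsTailField N P X P' Y) (s : Fin k → ℤ) {ε : ℝ} (hε : 0 < ε)
    (J : Finset (Fin k → ℤ)) (f : (J → Fin d → ℝ) →ᵇ ℝ)
    (hfs : ∀ y : (Fin k → ℤ) → Fin d → ℝ, N (y s) ≤ 1 → f (fun t => y t) = 0)
    (hf0 : ∀ y : (Fin k → ℤ) → Fin d → ℝ, N (y 0) ≤ ε → f (fun t => y t) = 0) :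
    ∫ ω, f (fun t => Y (t - s) ω) ∂P' = ε ^ (-α) * ∫ ω, f (fun t => ε • Y t ω) ∂P' := by
  let J' : Finset (Fin k → ℤ) := J.image (· - s)
  let f₁ : (J' → Fin d → ℝ) →ᵇ ℝ := f.compContinuous
    ⟨fun z t => z ⟨t - s, Finset.mem_image_of_mem _ t.2⟩,
      continuous_pi fun t => continuous_apply _⟩
  have h₁ : Tendsto (fun x : ℝ => (∫ ω, f (fun t => x⁻¹ • X (t - s) ω) ∂P) /
      P.real {ω | x < N (X 0 ω)}) atTop (𝓝 (∫ ω, f (fun t => Y (t - s) ω) ∂P')) := by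
    refine hY.tendsto_div J' f₁ fun y hy => ?_
    refine hfs (fun t => y (t - s)) ?_
    rwa [sub_self]
  let f₂ : (J → Fin d → ℝ) →ᵇ ℝ := f.compContinuous ⟨fun z => ε • z, continuous_const_smul ε⟩
  have h₂ : Tendsto (fun x : ℝ => (∫ ω, f (fun t => ε • x⁻¹ • X t ω) ∂P) /
      P.real {ω | x < N (X 0 ω)}) atTop (𝓝 (∫ ω, f (fun t => ε • Y t ω) ∂P')) := by
    refine hY.tendsto_div J f₂ fun y hy => ?_
    refine hf0 (fun t => ε • y t) ?_
    rw [map_smul_eq_mul, Real.norm_of_nonneg hε.le]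
    nlinarith
  have hst : ∀ x : ℝ, ∫ ω, f (fun t => x⁻¹ • X (t - s) ω) ∂P =
      ∫ ω, f (fun t => x⁻¹ • X t ω) ∂P := by
    intro x
    have hm : Measurable fun y : (Fin k → ℤ) → Fin d → ℝ => f (fun t : J => x⁻¹ • y t) := by
      refine f.continuous.measurable.comp (measurable_pi_lambda _ fun t => ?_)
      exact (measurable_pi_apply _).const_smul x⁻¹
    have := ((hXs (-s)).comp hm).integral_eq
    simpa only [Function.comp_def, ← sub_eq_add_neg] using this
  have hεt : Tendsto (fun x => ε * x) atTop atTop := tendsto_id.const_mul_atTop hε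
  -- At level εx the factor ε cancels: ε(εx)⁻¹X = x⁻¹X. Only the normalization changes, from P(N (X
  -- 0) > x) to P(N (X 0) > εx), at the cost of the factor ε^(-α).
  have h₃ := (tendsto_tail_div hN hXm hXrv hY hε).mul (h₂.comp hεt)
  refine tendsto_nhds_unique (h₁.congr' ?_) h₃
  have hpos := eventually_tail_pos hN hXm hXrv
  filter_upwards [hpos, hεt.eventually hpos] with x hx hεx
  simp only [hst, Function.comp, smul_smul, mul_inv, mul_inv_cancel_left₀ hε.ne']
  generalize P.real {ω | ε * x < N (X 0 ω)} = b at hεx ⊢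
  generalize P.real {ω | x < N (X 0 ω)} = a at hx ⊢
  field_simp

/-- Time change formula for the tail field, as an equality of measures away from the origin. -/
lemma restrict_map_shift_tailField [IsFiniteMeasure P] [IsFiniteMeasure P']
    (hN : ∀ v, N v = 0 → v = 0)
    (hXm : ∀ t, Measurable (X t)) (hXs : Stationary P X) (hXrv : JointlyRegularlyVarying P X α)
    (hYm : ∀ t, Measurable (Y t))
    (hY : IsTailField N P X P' Y) (s : Fin k → ℤ) {ε : ℝ} (hε : 0 < ε) :
    (P'.map fun ω t => Y (t - s) ω).restrict {y | 1 < N (y s) ∧ ε < N (y 0)} =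
      ENNReal.ofReal (ε ^ (-α)) •
        (P'.map fun ω t => ε • Y t ω).restrict {y | 1 < N (y s) ∧ ε < N (y 0)} := by
  have hNc := continuous_seminorm N
  -- A continuous weight, positive exactly on the open set B of the restriction. With density χ the
  -- two measures can be compared through bounded continuous functions; the density is then divided
  -- out on B.
  let χ : ((Fin k → ℤ) → Fin d → ℝ) → ℝ := fun y => ramp (N (y s)) * ramp (N (y 0) / ε)
  have hχm : Measurable χ :=
    (continuous_ramp.measurable.comp (hNc.measurable.comp (measurable_pi_apply s))).mul
      (continuous_ramp.measurable.comp
        ((hNc.measurable.comp (measurable_pi_apply 0)).div_const ε))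
  have hχ0 : ∀ y, 0 ≤ χ y := fun y => mul_nonneg (ramp_nonneg _) (ramp_nonneg _)
  have hχ1 : ∀ y, χ y ≤ 1 := fun y => mul_le_one₀ (ramp_le_one _) (ramp_nonneg _) (ramp_le_one _)
  let B : Set ((Fin k → ℤ) → Fin d → ℝ) := {y | 1 < N (y s) ∧ ε < N (y 0)}
  have hBm : MeasurableSet B :=
    (measurableSet_lt measurable_const (hNc.measurable.comp (measurable_pi_apply s))).inter
      (measurableSet_lt measurable_const (hNc.measurable.comp (measurable_pi_apply 0)))
  have hB : ∀ y, y ∈ B ↔ 0 < χ y := by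
    intro y
    have : 0 < χ y ↔ 0 < ramp (N (y s)) ∧ 0 < ramp (N (y 0) / ε) := by
      constructor
      · intro h
        exact ⟨pos_of_mul_pos_left h (ramp_nonneg _), pos_of_mul_pos_right h (ramp_nonneg _)⟩
      · exact fun h => mul_pos h.1 h.2
    rw [this, ramp_pos_iff, ramp_pos_iff, one_lt_div hε]
    rfl
  let w : ((Fin k → ℤ) → Fin d → ℝ) → ℝ≥0∞ := fun y => ENNReal.ofReal (χ y)
  have hwm : Measurable w := hχm.ennreal_ofReal
  -- Off B the product is 0 · ∞ = 0, so dividing the density out leaves the restriction to B.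
  have hww : w * w⁻¹ = B.indicator 1 := by
    ext y
    by_cases hy : y ∈ B
    · have : 0 < χ y := (hB y).1 hy
      simp only [Pi.mul_apply, Pi.inv_apply, indicator_of_mem hy, Pi.one_apply, w]
      exact ENNReal.mul_inv_cancel (ENNReal.ofReal_pos.2 this).ne' ENNReal.ofReal_ne_top
    · have : χ y = 0 := le_antisymm (not_lt.1 fun h => hy ((hB y).2 h)) (hχ0 y)
      simp [indicator_of_notMem hy, w, this]
  have hrestr : ∀ Q : Measure ((Fin k → ℤ) → Fin d → ℝ),
      Q.restrict B = (Q.withDensity w).withDensity w⁻¹ := by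
    intro Q
    rw [← withDensity_mul Q hwm hwm.inv, hww, withDensity_indicator_one hBm]
  have hm₁ : Measurable fun ω (t : Fin k → ℤ) => Y (t - s) ω :=
    measurable_pi_lambda _ fun t => hYm _
  have hm₂ : Measurable fun ω (t : Fin k → ℤ) => ε • Y t ω :=
    measurable_pi_lambda _ fun t => (hYm t).const_smul ε
  have hwd : (P'.map fun ω t => Y (t - s) ω).withDensity w =
      ENNReal.ofReal (ε ^ (-α)) • (P'.map fun ω t => ε • Y t ω).withDensity w := by
    have hfin : ∀ (Q : Measure ((Fin k → ℤ) → Fin d → ℝ)) [IsFiniteMeasure Q],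
        IsFiniteMeasure (Q.withDensity w) := fun Q _ => by
      refine isFiniteMeasure_withDensity_ofReal ?_
      exact (Integrable.of_bound hχm.aestronglyMeasurable 1
        (ae_of_all _ fun y => by rw [Real.norm_of_nonneg (hχ0 y)]; exact hχ1 y)).2
    have := Measure.isFiniteMeasure_map P' fun ω (t : Fin k → ℤ) => Y (t - s) ω
    have := Measure.isFiniteMeasure_map P' fun ω (t : Fin k → ℤ) => ε • Y t ω
    have := hfin (P'.map fun ω t => Y (t - s) ω)
    have := hfin (P'.map fun ω t => ε • Y t ω)
    have : IsFiniteMeasure (ENNReal.ofReal (ε ^ (-α)) •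
        (P'.map fun ω t => ε • Y t ω).withDensity w) :=
      Measure.smul_finite _ ENNReal.ofReal_ne_top
    refine ext_of_forall_integral_restrict_eq fun I f => ?_
    have hfm : Measurable fun y : (Fin k → ℤ) → Fin d → ℝ => f (fun t => y t) :=
      f.continuous.measurable.comp (measurable_pi_lambda _ fun t => measurable_pi_apply _)
    have hχf : Measurable fun y => χ y * f (fun t => y t) := hχm.mul hfm
    have hint : ∀ Q : Measure ((Fin k → ℤ) → Fin d → ℝ),
        ∫ y, f (fun t => y t) ∂(Q.withDensity w) = ∫ y, χ y * f (fun t => y t) ∂Q := by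
      intro Q
      rw [integral_withDensity_eq_integral_toReal_smul hwm
        (ae_of_all _ fun y => ENNReal.ofReal_lt_top)]
      simp only [w, ENNReal.toReal_ofReal (hχ0 _), smul_eq_mul]
    rw [integral_smul_measure, hint, hint, ENNReal.toReal_ofReal (Real.rpow_nonneg hε.le _),
      integral_map hm₁.aemeasurable hχf.aestronglyMeasurable,
      integral_map hm₂.aemeasurable hχf.aestronglyMeasurable, smul_eq_mul]
    -- The sites 0 and s are added so that the weight χ also depends only on the values on `J`.
    let J : Finset (Fin k → ℤ) := insert 0 (insert s I)
    have h0J : 0 ∈ J := Finset.mem_insert_self _ _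
    have hsJ : s ∈ J := Finset.mem_insert_of_mem (Finset.mem_insert_self _ _)
    have hIJ : ∀ t ∈ I, t ∈ J := fun t ht =>
      Finset.mem_insert_of_mem (Finset.mem_insert_of_mem ht)
    let f' : (J → Fin d → ℝ) →ᵇ ℝ := BoundedContinuousFunction.ofNormedAddCommGroup
      (fun z => ramp (N (z ⟨s, hsJ⟩)) * ramp (N (z ⟨0, h0J⟩) / ε) *
        f (fun t => z ⟨t, hIJ t t.2⟩))
      (((continuous_ramp.comp (hNc.comp (continuous_apply _))).mul
        (continuous_ramp.comp ((hNc.comp (continuous_apply _)).div_const ε))).mul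
        (f.continuous.comp (continuous_pi fun t => continuous_apply _))) ‖f‖
      (fun z => by
        rw [norm_mul, norm_mul, Real.norm_of_nonneg (ramp_nonneg _),
          Real.norm_of_nonneg (ramp_nonneg _)]
        refine (mul_le_of_le_one_left (norm_nonneg _) ?_).trans (f.norm_coe_le_norm _)
        exact mul_le_one₀ (ramp_le_one _) (ramp_nonneg _) (ramp_le_one _))
    refine integral_shift_tailField hN hXm hXs hXrv hY s hε J f' ?_ ?_
    · intro y hy
      change ramp (N (y s)) * _ * _ = 0
      rw [ramp_of_le_one hy, zero_mul, zero_mul]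
    · intro y hy
      change _ * ramp (N (y 0) / ε) * _ = 0
      rw [ramp_of_le_one ((div_le_one hε).2 hy), mul_zero, zero_mul]
  change (P'.map fun ω t => Y (t - s) ω).restrict B =
    ENNReal.ofReal (ε ^ (-α)) • (P'.map fun ω t => ε • Y t ω).restrict B
  rw [hrestr, hrestr, hwd, withDensity_smul_measure]

end TimeChange

/-! ### The measure d(-r^(-α)), polar decomposition and the tail measure -/

instance (α : ℝ) : SigmaFinite (powerMeasure α) := SigmaFinite.withDensity_ofReal _

lemma ae_powerMeasure_pos (α : ℝ) : ∀ᵐ r ∂powerMeasure α, 0 < r :=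
  (withDensity_absolutelyContinuous _ _).ae_le (ae_restrict_mem measurableSet_Ioi)

lemma powerMeasure_Ioi {α : ℝ} (hα : 0 < α) {u : ℝ} (hu : 0 < u) :
    powerMeasure α (Ioi u) = ENNReal.ofReal (u ^ (-α)) := by
  have hsub : Ioi u ∩ Ioi 0 = Ioi u := inter_eq_left.2 fun x hx => hu.trans hx
  have hlt : -α - 1 < -1 := by linarith
  rw [powerMeasure, withDensity_apply _ measurableSet_Ioi,
    Measure.restrict_restrict measurableSet_Ioi, hsub,
    ← ofReal_integral_eq_lintegral_ofReal ((integrableOn_Ioi_rpow_of_lt hlt hu).const_mul α)]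
  · rw [integral_const_mul, integral_Ioi_rpow_of_lt hlt hu, sub_add_cancel]
    congr 1
    field_simp
  · filter_upwards [ae_restrict_mem measurableSet_Ioi] with r hr
    have : 0 < r := hu.trans hr
    exact mul_nonneg hα.le (Real.rpow_nonneg this.le _)

section TailMeasure

variable {Ω Ω' : Type*} [MeasurableSpace Ω] [MeasurableSpace Ω'] {k d : ℕ}
  {N : Seminorm ℝ (Fin d → ℝ)} {P : Measure Ω} {P' : Measure Ω'} {α : ℝ}
  {X : (Fin k → ℤ) → Ω → (Fin d → ℝ)} {Y : (Fin k → ℤ) → Ω' → (Fin d → ℝ)}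

lemma measurable_spectralField (hYm : ∀ t, Measurable (Y t)) (t : Fin k → ℤ) :
    Measurable (spectralField N Y t) :=
  (measurable_norm_field hYm 0).inv.smul (hYm t)

lemma measurable_field {E : Type*} [MeasurableSpace E] {Z : (Fin k → ℤ) → Ω → E}
    (hZ : ∀ t, Measurable (Z t)) : Measurable fun ω t => Z t ω :=
  measurable_pi_lambda _ hZ

lemma measurable_seminorm_apply (N : Seminorm ℝ (Fin d → ℝ)) (t : Fin k → ℤ) :
    Measurable fun y : (Fin k → ℤ) → Fin d → ℝ => N (y t) :=
  (continuous_seminorm N).measurable.comp (measurable_pi_apply t)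

/-- The norm at the origin of the tail field has a Pareto tail and is independent of the
spectral field. -/
lemma measure_tail_inter_spectralField [IsFiniteMeasure P] [IsProbabilityMeasure P']
    (hN : ∀ v, N v = 0 → v = 0)
    (hXm : ∀ t, Measurable (X t)) (hXs : Stationary P X) (hXrv : JointlyRegularlyVarying P X α)
    (hYm : ∀ t, Measurable (Y t)) (hY : IsTailField N P X P' Y)
    {u : ℝ} (hu : 1 ≤ u) {A : Set ((Fin k → ℤ) → Fin d → ℝ)} (hA : MeasurableSet A) :
    P' {ω | u < N (Y 0 ω) ∧ (fun t => spectralField N Y t ω) ∈ A} =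
      ENNReal.ofReal (u ^ (-α)) * P' {ω | (fun t => spectralField N Y t ω) ∈ A} := by
  have hu0 : 0 < u := zero_lt_one.trans_le hu
  let B : Set ((Fin k → ℤ) → Fin d → ℝ) := {y | 1 < N (y 0) ∧ u < N (y 0)}
  let D : Set ((Fin k → ℤ) → Fin d → ℝ) := {y | (fun t => (N (y 0))⁻¹ • y t) ∈ A}
  have hB : MeasurableSet B :=
    (measurableSet_lt measurable_const (measurable_seminorm_apply N 0)).inter
      (measurableSet_lt measurable_const (measurable_seminorm_apply N 0))
  have hD : MeasurableSet D :=
    (measurable_pi_lambda _ fun t =>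
      (measurable_seminorm_apply N 0).inv.smul (measurable_pi_apply t)) hA
  -- The time change with shift 0 and scale u, evaluated on a set invariant under positive scaling
  -- wherever y 0 has nonzero norm. Almost surely N(uY(0)) > u ≥ 1, so on the scaled side the
  -- restriction to B costs nothing.
  have h := congrArg (fun μ => μ D)
    (restrict_map_shift_tailField hN hXm hXs hXrv hYm hY 0 hu0)
  simp only [sub_zero, Measure.smul_apply, smul_eq_mul] at h
  have hm₁ : Measurable fun ω (t : Fin k → ℤ) => Y t ω := measurable_field hYm
  have hm₂ : Measurable fun ω (t : Fin k → ℤ) => u • Y t ω :=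
    measurable_pi_lambda _ fun t => (hYm t).const_smul u
  rw [Measure.restrict_apply hD, Measure.restrict_apply hD, Measure.map_apply hm₁ (hD.inter hB),
    Measure.map_apply hm₂ (hD.inter hB)] at h
  have hae := ae_one_lt_tailField hN hXm hXrv hYm hY
  have e1 : P' {ω | u < N (Y 0 ω) ∧ (fun t => spectralField N Y t ω) ∈ A} =
      P' ((fun ω t => Y t ω) ⁻¹' (D ∩ B)) := by
    congr 1
    ext ω
    constructor
    · rintro ⟨h1, h2⟩
      exact ⟨h2, hu.trans_lt h1, h1⟩
    · rintro ⟨h2, -, h1⟩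
      exact ⟨h1, h2⟩
  have e2 : P' {ω | (fun t => spectralField N Y t ω) ∈ A} =
      P' ((fun ω t => u • Y t ω) ⁻¹' (D ∩ B)) := by
    refine measure_congr ?_
    filter_upwards [hae] with ω hω
    have hNu : N (u • Y 0 ω) = u * N (Y 0 ω) := by
      rw [map_smul_eq_mul, Real.norm_of_nonneg hu0.le]
    have hsp : (fun t => (N (u • Y 0 ω))⁻¹ • u • Y t ω) = fun t => spectralField N Y t ω := by
      ext1 t
      rw [hNu, smul_smul, spectralField]
      congr 1
      field_simp
    have hlt : u < N (u • Y 0 ω) := by rw [hNu]; nlinarith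
    refine propext ⟨fun h => ⟨?_, hu.trans_lt hlt, hlt⟩, fun h => ?_⟩
    · change (fun t => (N (u • Y 0 ω))⁻¹ • u • Y t ω) ∈ A
      rwa [hsp]
    · have := h.1
      change (fun t => (N (u • Y 0 ω))⁻¹ • u • Y t ω) ∈ A at this
      rwa [hsp] at this
  rw [e1, e2]
  exact h

/-- The measure d(-r^(-α)) is infinite near 0, but on (ε, ∞) it is ε^(-α) times the law of ε times a
Pareto variable. N (Y 0) is such a variable, independent of Θ. -/
lemma prod_powerMeasure_spectralField [IsFiniteMeasure P] [IsProbabilityMeasure P'] (hα : 0 < α)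
    (hN : ∀ v, N v = 0 → v = 0)
    (hXm : ∀ t, Measurable (X t)) (hXs : Stationary P X) (hXrv : JointlyRegularlyVarying P X α)
    (hYm : ∀ t, Measurable (Y t)) (hY : IsTailField N P X P' Y) {ε : ℝ} (hε : 0 < ε) :
    ((powerMeasure α).restrict (Ioi ε)).prod (P'.map fun ω t => spectralField N Y t ω) =
      ENNReal.ofReal (ε ^ (-α)) •
        P'.map fun ω => (ε * N (Y 0 ω), fun t => spectralField N Y t ω) := by
  have hae := ae_one_lt_tailField hN hXm hXrv hYm hY
  have hΘm : Measurable fun ω t => spectralField N Y t ω :=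
    measurable_field (measurable_spectralField hYm)
  have hNm : Measurable fun ω => ε * N (Y 0 ω) := (measurable_norm_field hYm 0).const_mul ε
  have := Measure.isFiniteMeasure_map P' fun ω t => spectralField N Y t ω
  refine Measure.prod_eq fun S A hS hA => ?_
  let C : Set Ω' := (fun ω t => spectralField N Y t ω) ⁻¹' A
  have hC : MeasurableSet C := hΘm hA
  -- For fixed A both sides are finite measures in S, so half-lines suffice. Since N (Y 0) > 1
  -- almost surely, the level u may be replaced by max(u, ε), which makes the threshold max(u, ε)/ε
  -- at least 1.
  have key : ENNReal.ofReal (ε ^ (-α)) • (P'.restrict C).map (fun ω => ε * N (Y 0 ω)) =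
      P' C • (powerMeasure α).restrict (Ioi ε) := by
    have := Measure.isFiniteMeasure_map (P'.restrict C) fun ω => ε * N (Y 0 ω)
    have : IsFiniteMeasure
        (ENNReal.ofReal (ε ^ (-α)) • (P'.restrict C).map (fun ω => ε * N (Y 0 ω))) :=
      Measure.smul_finite _ ENNReal.ofReal_ne_top
    refine ext_of_generate_finite (range Ioi)
      (by rw [← borel_eq_generateFrom_Ioi ℝ]; exact BorelSpace.measurable_eq) isPiSystem_Ioi ?_ ?_
    · rintro _ ⟨u, rfl⟩
      have hmax : 0 < max u ε := lt_max_of_lt_right hε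
      rw [Measure.smul_apply, Measure.smul_apply, Measure.map_apply hNm measurableSet_Ioi,
        Measure.restrict_apply (hNm measurableSet_Ioi), Measure.restrict_apply measurableSet_Ioi,
        Ioi_inter_Ioi, powerMeasure_Ioi hα hmax, smul_eq_mul, smul_eq_mul]
      have h1 : P' ((fun ω => ε * N (Y 0 ω)) ⁻¹' Ioi u ∩ C) =
          P' {ω | max u ε / ε < N (Y 0 ω) ∧ (fun t => spectralField N Y t ω) ∈ A} := by
        refine measure_congr ?_
        filter_upwards [hae] with ω hω
        refine propext (and_congr_left fun _ => ?_)
        change u < ε * N (Y 0 ω) ↔ max u ε / ε < N (Y 0 ω)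
        rw [div_lt_iff₀ hε, max_lt_iff, mul_comm]
        exact ⟨fun h => ⟨h, by nlinarith⟩, fun h => h.1⟩
      rw [h1, measure_tail_inter_spectralField hN hXm hXs hXrv hYm hY
        ((one_le_div hε).2 (le_max_right _ _)) hA, ← mul_assoc,
        ← ENNReal.ofReal_mul (Real.rpow_nonneg hε.le _),
        ← Real.mul_rpow hε.le (div_pos hmax hε).le, mul_div_cancel₀ _ hε.ne', mul_comm]
      rfl
    · rw [Measure.smul_apply, Measure.smul_apply, Measure.map_apply hNm MeasurableSet.univ,
        preimage_univ, Measure.restrict_apply_univ, Measure.restrict_apply_univ,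
        powerMeasure_Ioi hα hε, smul_eq_mul, smul_eq_mul, mul_comm]
  have hkS := congrArg (fun μ => μ S) key
  simp only [Measure.smul_apply, smul_eq_mul] at hkS
  rw [Measure.map_apply hNm hS, Measure.restrict_apply (hNm hS)] at hkS
  rw [Measure.smul_apply, Measure.map_apply (hNm.prodMk hΘm) (hS.prod hA),
    Measure.map_apply hΘm hA, mul_comm]
  exact hkS

/-- The tail measure: the image of `d(-r^{-α}) ⊗ P'` under `(r, ω) ↦ r Θ(ω)`. -/
noncomputable def tailMeasure (N : Seminorm ℝ (Fin d → ℝ)) (P' : Measure Ω')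
    (Y : (Fin k → ℤ) → Ω' → (Fin d → ℝ)) (α : ℝ) : Measure ((Fin k → ℤ) → Fin d → ℝ) :=
  ((powerMeasure α).prod P').map fun z t => z.1 • spectralField N Y t z.2

lemma measurable_smul_spectralField (hYm : ∀ t, Measurable (Y t)) :
    Measurable fun (z : ℝ × Ω') t => z.1 • spectralField N Y t z.2 :=
  measurable_pi_lambda _ fun t =>
    measurable_fst.smul ((measurable_spectralField hYm t).comp measurable_snd)

lemma ae_prod_pos_and_norm_spectralField [IsFiniteMeasure P] [IsProbabilityMeasure P']
    (hN : ∀ v, N v = 0 → v = 0)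
    (hXm : ∀ t, Measurable (X t)) (hXrv : JointlyRegularlyVarying P X α)
    (hYm : ∀ t, Measurable (Y t)) (hY : IsTailField N P X P' Y) :
    ∀ᵐ z ∂(powerMeasure α).prod P', 0 < z.1 ∧ N (spectralField N Y 0 z.2) = 1 := by
  have h1 : ∀ᵐ ω ∂P', N (spectralField N Y 0 ω) = 1 := by
    filter_upwards [ae_one_lt_tailField hN hXm hXrv hYm hY] with ω hω
    rw [spectralField, map_smul_eq_mul, norm_inv, Real.norm_of_nonneg (apply_nonneg N _),
      inv_mul_cancel₀ (zero_lt_one.trans hω).ne']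
  filter_upwards [Measure.quasiMeasurePreserving_fst.ae (ae_powerMeasure_pos α),
    Measure.quasiMeasurePreserving_snd.ae h1] with z hz1 hz2
  exact ⟨hz1, hz2⟩

/-- Since N(Θ(0)) = 1 almost surely, r is the norm of rΘ at the origin, and the restriction amounts
to r > ε. There r may be replaced by εN(Y(0)), and εN(Y(0))Θ = εY. -/
lemma restrict_tailMeasure [IsFiniteMeasure P] [IsProbabilityMeasure P'] (hα : 0 < α)
    (hN : ∀ v, N v = 0 → v = 0)
    (hXm : ∀ t, Measurable (X t)) (hXs : Stationary P X) (hXrv : JointlyRegularlyVarying P X α)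
    (hYm : ∀ t, Measurable (Y t)) (hY : IsTailField N P X P' Y) {ε : ℝ} (hε : 0 < ε) :
    (tailMeasure N P' Y α).restrict {y | ε < N (y 0)} =
      ENNReal.ofReal (ε ^ (-α)) • P'.map fun ω t => ε • Y t ω := by
  have hT := measurable_smul_spectralField (N := N) hYm
  have hΘm : Measurable fun ω t => spectralField N Y t ω :=
    measurable_field (measurable_spectralField hYm)
  have hS : Measurable fun (z : ℝ × ((Fin k → ℤ) → Fin d → ℝ)) t => z.1 • z.2 t :=
    measurable_pi_lambda _ fun t =>
      measurable_fst.smul ((measurable_pi_apply t).comp measurable_snd)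
  have hNm : Measurable fun ω => ε * N (Y 0 ω) := (measurable_norm_field hYm 0).const_mul ε
  have hset : ((fun (z : ℝ × Ω') t => z.1 • spectralField N Y t z.2) ⁻¹' {y | ε < N (y 0)} :
      Set (ℝ × Ω')) =ᵐ[(powerMeasure α).prod P'] Ioi ε ×ˢ univ := by
    filter_upwards [ae_prod_pos_and_norm_spectralField hN hXm hXrv hYm hY] with z hz
    have : N (z.1 • spectralField N Y 0 z.2) = z.1 := by
      rw [map_smul_eq_mul, hz.2, mul_one, Real.norm_of_nonneg hz.1.le]
    refine propext ⟨fun h => ⟨?_, mem_univ _⟩, fun h => ?_⟩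
    · change ε < N (z.1 • spectralField N Y 0 z.2) at h
      rwa [this] at h
    · change ε < N (z.1 • spectralField N Y 0 z.2)
      rw [this]
      exact h.1
  have hprod : (((powerMeasure α).restrict (Ioi ε)).prod P').map
      (Prod.map id fun ω t => spectralField N Y t ω) =
      ((powerMeasure α).restrict (Ioi ε)).prod (P'.map fun ω t => spectralField N Y t ω) := by
    rw [← Measure.map_prod_map _ _ measurable_id hΘm, Measure.map_id]
  rw [tailMeasure, Measure.restrict_map hT (measurableSet_lt measurable_const
    (measurable_seminorm_apply N 0)), Measure.restrict_congr_set hset, ← Measure.prod_restrict,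
    Measure.restrict_univ]
  have hcomp : (fun (z : ℝ × Ω') t => z.1 • spectralField N Y t z.2) =
      (fun (z : ℝ × ((Fin k → ℤ) → Fin d → ℝ)) t => z.1 • z.2 t) ∘
        (Prod.map id fun ω t => spectralField N Y t ω) := rfl
  rw [hcomp, ← Measure.map_map hS (measurable_id.prodMap hΘm), hprod,
    prod_powerMeasure_spectralField hα hN hXm hXs hXrv hYm hY hε, Measure.map_smul,
    Measure.map_map hS (hNm.prodMk hΘm)]
  congr 1
  refine Measure.map_congr ?_
  filter_upwards [ae_one_lt_tailField hN hXm hXrv hYm hY] with ω hω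
  ext1 t
  have : N (Y 0 ω) ≠ 0 := (zero_lt_one.trans hω).ne'
  change (ε * N (Y 0 ω)) • (N (Y 0 ω))⁻¹ • Y t ω = _
  rw [smul_smul, mul_assoc, mul_inv_cancel₀ this, mul_one]

/-- Time change formula: the shifted tail field, where it does not vanish at the origin, has the
law of the tail measure restricted to the fields exceeding `1` in norm at `s`. -/
lemma restrict_map_shift_eq_restrict_tailMeasure [IsFiniteMeasure P] [IsProbabilityMeasure P']
    (hα : 0 < α) (hN : ∀ v, N v = 0 → v = 0)
    (hXm : ∀ t, Measurable (X t)) (hXs : Stationary P X) (hXrv : JointlyRegularlyVarying P X α)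
    (hYm : ∀ t, Measurable (Y t)) (hY : IsTailField N P X P' Y) (s : Fin k → ℤ) :
    (P'.map fun ω t => Y (t - s) ω).restrict {y | y 0 ≠ 0} =
      (tailMeasure N P' Y α).restrict {y | 1 < N (y s)} := by
  have hm : Measurable fun ω (t : Fin k → ℤ) => Y (t - s) ω :=
    measurable_pi_lambda _ fun t => hYm _
  -- The time change is available only away from y 0 = 0; the sets D n exhaust N (y 0) > 0, and on
  -- each both measures equal the same multiple of a scaled tail field law.
  let D : ℕ → Set ((Fin k → ℤ) → Fin d → ℝ) := fun n =>
    {y | 1 < N (y s) ∧ 1 / ((n : ℝ) + 1) < N (y 0)}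
  have hs : MeasurableSet {y : (Fin k → ℤ) → Fin d → ℝ | 1 < N (y s)} :=
    measurableSet_lt measurable_const (measurable_seminorm_apply N s)
  have h0 : ∀ ε : ℝ, MeasurableSet {y : (Fin k → ℤ) → Fin d → ℝ | ε < N (y 0)} := fun ε =>
    measurableSet_lt measurable_const (measurable_seminorm_apply N 0)
  have hD : ⋃ n, D n = {y | 1 < N (y s) ∧ 0 < N (y 0)} := by
    ext y
    simp only [D, mem_iUnion, mem_ofPred_eq]
    constructor
    · rintro ⟨n, h1, h2⟩
      exact ⟨h1, lt_trans (by positivity) h2⟩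
    · rintro ⟨h1, h2⟩
      obtain ⟨n, hn⟩ := exists_nat_one_div_lt h2
      exact ⟨n, h1, hn⟩
  have key : (P'.map fun ω t => Y (t - s) ω).restrict (⋃ n, D n) =
      (tailMeasure N P' Y α).restrict (⋃ n, D n) := by
    refine Measure.restrict_iUnion_congr.2 fun n => ?_
    have hε : 0 < 1 / ((n : ℝ) + 1) := by positivity
    have hsub : D n ∩ {y | 1 / ((n : ℝ) + 1) < N (y 0)} = D n := inter_eq_left.2 fun y hy => hy.2
    have hDn : MeasurableSet (D n) := hs.inter (h0 _)
    calc _ = _ := restrict_map_shift_tailField hN hXm hXs hXrv hYm hY s hε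
      _ = (ENNReal.ofReal ((1 / ((n : ℝ) + 1)) ^ (-α)) •
          P'.map fun ω t => (1 / ((n : ℝ) + 1)) • Y t ω).restrict (D n) :=
        (Measure.restrict_smul _ _ _).symm
      _ = _ := by
        rw [← restrict_tailMeasure hα hN hXm hXs hXrv hYm hY hε, Measure.restrict_restrict hDn, hsub]
  rw [hD] at key
  -- Each side carries one of the two conditions for free: the shifted field has norm N (Y 0) > 1 at
  -- s, and the tail measure gives norm r > 0 at the origin.
  have e1 : ({y | y 0 ≠ 0} : Set ((Fin k → ℤ) → Fin d → ℝ)) =ᵐ[P'.map fun ω t => Y (t - s) ω]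
      {y | 1 < N (y s) ∧ 0 < N (y 0)} := by
    have : ∀ᵐ y ∂(P'.map fun ω t => Y (t - s) ω), 1 < N (y s) := by
      rw [ae_map_iff hm.aemeasurable hs]
      filter_upwards [ae_one_lt_tailField hN hXm hXrv hYm hY] with ω hω
      rwa [sub_self]
    filter_upwards [this] with y hy
    refine propext ⟨fun h => ⟨hy, ?_⟩, fun h h' => ?_⟩
    · exact lt_of_le_of_ne (apply_nonneg N _) fun h' => h (hN _ h'.symm)
    · have h2 := h.2
      rw [h', map_zero] at h2
      exact lt_irrefl _ h2
  have e2 : ({y | 1 < N (y s)} : Set ((Fin k → ℤ) → Fin d → ℝ)) =ᵐ[tailMeasure N P' Y α]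
      {y | 1 < N (y s) ∧ 0 < N (y 0)} := by
    have : ∀ᵐ y ∂(tailMeasure N P' Y α), 0 < N (y 0) := by
      rw [tailMeasure, ae_map_iff (measurable_smul_spectralField hYm).aemeasurable (h0 0)]
      filter_upwards [ae_prod_pos_and_norm_spectralField hN hXm hXrv hYm hY] with z hz
      rw [map_smul_eq_mul, hz.2, mul_one]
      exact norm_pos_iff.2 hz.1.ne'
    filter_upwards [this] with y hy
    exact propext ⟨fun h => ⟨h, hy⟩, fun h => h.1⟩
  rw [Measure.restrict_congr_set e1, Measure.restrict_congr_set e2, key]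

/-- Time change formula for bounded measurable functions, with the right-hand side as an integral
over a product space. -/
lemma integral_shift_eq_integral_prod [IsFiniteMeasure P] [IsProbabilityMeasure P']
    (hα : 0 < α) (hN : ∀ v, N v = 0 → v = 0)
    (hXm : ∀ t, Measurable (X t)) (hXs : Stationary P X) (hXrv : JointlyRegularlyVarying P X α)
    (hYm : ∀ t, Measurable (Y t)) (hY : IsTailField N P X P' Y)
    {g : ((Fin k → ℤ) → Fin d → ℝ) → ℝ} (hgm : Measurable g) (hgb : ∃ C, ∀ y, |g y| ≤ C)
    (s : Fin k → ℤ) :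
    Integrable (fun z : ℝ × Ω' => g (fun t => z.1 • spectralField N Y t z.2) *
        indicator {ω | 1 < z.1 * N (spectralField N Y s ω)} 1 z.2) ((powerMeasure α).prod P') ∧
      ∫ ω, g (fun t => Y (t - s) ω) * indicator {ω | Y (-s) ω ≠ 0} 1 ω ∂P' =
        ∫ z : ℝ × Ω', g (fun t => z.1 • spectralField N Y t z.2) *
          indicator {ω | 1 < z.1 * N (spectralField N Y s ω)} 1 z.2 ∂(powerMeasure α).prod P' := by
  obtain ⟨C, hC⟩ := hgb
  have hm : Measurable fun ω (t : Fin k → ℤ) => Y (t - s) ω :=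
    measurable_pi_lambda _ fun t => hYm _
  have hT := measurable_smul_spectralField (N := N) hYm
  have hmain := restrict_map_shift_eq_restrict_tailMeasure hα hN hXm hXs hXrv hYm hY s
  have := Measure.isFiniteMeasure_map P' fun ω (t : Fin k → ℤ) => Y (t - s) ω
  have hs : MeasurableSet {y : (Fin k → ℤ) → Fin d → ℝ | 1 < N (y s)} :=
    measurableSet_lt measurable_const (measurable_seminorm_apply N s)
  have h0 : MeasurableSet {y : (Fin k → ℤ) → Fin d → ℝ | y 0 ≠ 0} :=
    ((measurable_pi_apply 0) (measurableSet_singleton 0)).compl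
  have hint : Integrable g ((P'.map fun ω t => Y (t - s) ω).restrict {y | y 0 ≠ 0}) :=
    Integrable.of_bound hgm.aestronglyMeasurable C (ae_of_all _ hC)
  -- The tail measure is infinite, but by the time change its restriction to N (y s) > 1 is finite,
  -- so bounded functions are integrable there.
  have hint' : Integrable ({y | 1 < N (y s)}.indicator g) (tailMeasure N P' Y α) := by
    rw [integrable_indicator_iff hs, IntegrableOn, ← hmain]
    exact hint
  have hgm' : Measurable ({y | 1 < N (y s)}.indicator g) := hgm.indicator hs
  have hae : (fun z : ℝ × Ω' => g (fun t => z.1 • spectralField N Y t z.2) *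
        indicator {ω | 1 < z.1 * N (spectralField N Y s ω)} 1 z.2) =ᵐ[(powerMeasure α).prod P']
      ({y | 1 < N (y s)}.indicator g) ∘ fun z t => z.1 • spectralField N Y t z.2 := by
    filter_upwards [Measure.quasiMeasurePreserving_fst.ae (ae_powerMeasure_pos α)] with z hz
    have : N (z.1 • spectralField N Y s z.2) = z.1 * N (spectralField N Y s z.2) := by
      rw [map_smul_eq_mul, Real.norm_of_nonneg hz.le]
    simp only [Function.comp, indicator, mem_ofPred_eq, this, Pi.one_apply, mul_ite, mul_one,
      mul_zero]
  constructor
  · rw [integrable_congr hae]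
    exact hint'.comp_measurable hT
  · rw [integral_congr_ae hae]
    have h1 : ∫ z, (({y | 1 < N (y s)}.indicator g) ∘ fun (z : ℝ × Ω') t =>
        z.1 • spectralField N Y t z.2) z ∂(powerMeasure α).prod P' =
        ∫ y, {y | 1 < N (y s)}.indicator g y ∂(tailMeasure N P' Y α) :=
      (integral_map hT.aemeasurable hgm'.aestronglyMeasurable).symm
    rw [h1, integral_indicator hs, ← hmain, ← integral_indicator h0,
      integral_map hm.aemeasurable (hgm.indicator h0).aestronglyMeasurable]
    refine integral_congr_ae (ae_of_all _ fun ω => ?_)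
    simp only [indicator, mem_ofPred_eq, zero_sub, Pi.one_apply, mul_ite, mul_one, mul_zero]

end TailMeasure

end RegVar

/-! ### The two identities -/

theorem theorem3p2 {Ω Ω' : Type*} [MeasurableSpace Ω] [MeasurableSpace Ω'] {k d : ℕ}
    (N : Seminorm ℝ (Fin d → ℝ)) (hN : ∀ v, N v = 0 → v = 0)
    (P : Measure Ω) [IsProbabilityMeasure P] (P' : Measure Ω') [IsProbabilityMeasure P']
    (α : ℝ) (hα : 0 < α)
    (X : (Fin k → ℤ) → Ω → (Fin d → ℝ)) (hXm : ∀ t, Measurable (X t))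
    (hXs : RegVar.Stationary P X) (hXrv : RegVar.JointlyRegularlyVarying P X α)
    (Y : (Fin k → ℤ) → Ω' → (Fin d → ℝ)) (hYm : ∀ t, Measurable (Y t))
    (hY : RegVar.IsTailField N P X P' Y)
    (Θ : (Fin k → ℤ) → Ω' → (Fin d → ℝ)) (hΘ : Θ = RegVar.spectralField N Y)
    (g : ((Fin k → ℤ) → Fin d → ℝ) → ℝ) (hgm : Measurable g) (hgb : ∃ C, ∀ y, |g y| ≤ C)
    (s : Fin k → ℤ) :
    (Integrable (fun r : ℝ => ∫ ω, g (fun t => r • Θ t ω) *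
        Set.indicator {ω | 1 < r * N (Θ s ω)} 1 ω ∂P') (RegVar.powerMeasure α) ∧
      ∫ ω, g (fun t => Y (t - s) ω) * Set.indicator {ω | Y (-s) ω ≠ 0} 1 ω ∂P' =
        ∫ r, (∫ ω, g (fun t => r • Θ t ω) *
          Set.indicator {ω | 1 < r * N (Θ s ω)} 1 ω ∂P') ∂(RegVar.powerMeasure α)) ∧
    (Integrable (fun ω => g (fun t => (N (Θ s ω))⁻¹ • Θ t ω) * N (Θ s ω) ^ α) P' ∧
      ∫ ω, g (fun t => Θ (t - s) ω) * Set.indicator {ω | Θ (-s) ω ≠ 0} 1 ω ∂P' =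
        ∫ ω, g (fun t => (N (Θ s ω))⁻¹ • Θ t ω) * N (Θ s ω) ^ α ∂P') := by
  subst hΘ
  constructor
  · obtain ⟨h1, h2⟩ := RegVar.integral_shift_eq_integral_prod hα hN hXm hXs hXrv hYm hY hgm hgb s
    exact ⟨h1.integral_prod_left, h2.trans (integral_prod _ h1)⟩
  -- Normalizing by the norm at s makes `g ∘ h` invariant under positive scaling. Integrating over r
  -- first then leaves only the mass of r > 1/N(Θ(s)), which is N(Θ(s))^α.
  · let h : ((Fin k → ℤ) → Fin d → ℝ) → (Fin k → ℤ) → Fin d → ℝ := fun y t => (N (y s))⁻¹ • y t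
    have hh : Measurable h := measurable_pi_lambda _ fun t =>
      (RegVar.measurable_seminorm_apply N s).inv.smul (measurable_pi_apply t)
    obtain ⟨h1, h2⟩ := RegVar.integral_shift_eq_integral_prod hα hN hXm hXs hXrv hYm hY
      (hgm.comp hh) (hgb.imp fun C hC y => hC _) s
    have hinner : ∀ ω, ∫ r, (g ∘ h) (fun t => r • RegVar.spectralField N Y t ω) *
        indicator {ω | 1 < r * N (RegVar.spectralField N Y s ω)} 1 ω ∂(RegVar.powerMeasure α) =
        g (fun t => (N (RegVar.spectralField N Y s ω))⁻¹ • RegVar.spectralField N Y t ω) *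
          N (RegVar.spectralField N Y s ω) ^ α := by
      intro ω
      generalize RegVar.spectralField N Y = Θ
      rcases (apply_nonneg N (Θ s ω)).eq_or_lt with hz | hpos
      -- Where Θ(s) = 0 the indicator is empty on the left, and 0^α = 0 on the right because α > 0.
      · simp [indicator, ← hz, Real.zero_rpow hα.ne', zero_lt_one.not_gt]
      · have hae : (fun r => (g ∘ h) (fun t => r • Θ t ω) *
            indicator {ω | 1 < r * N (Θ s ω)} 1 ω) =ᵐ[RegVar.powerMeasure α]
            fun r => g (fun t => (N (Θ s ω))⁻¹ • Θ t ω) * (Ioi (N (Θ s ω))⁻¹).indicator 1 r := by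
          filter_upwards [RegVar.ae_powerMeasure_pos α] with r hr
          have hhr : h (fun t => r • Θ t ω) = fun t => (N (Θ s ω))⁻¹ • Θ t ω := by
            ext1 t
            change (N (r • Θ s ω))⁻¹ • r • Θ t ω = _
            rw [map_smul_eq_mul, Real.norm_of_nonneg hr.le, smul_smul]
            congr 1
            field_simp
          rw [Function.comp_apply, hhr]
          congr 1
          simp only [indicator, mem_ofPred_eq, mem_Ioi, inv_lt_iff_one_lt_mul₀ hpos, Pi.one_apply]
        rw [integral_congr_ae hae, integral_const_mul, integral_indicator_one measurableSet_Ioi,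
          Measure.real, RegVar.powerMeasure_Ioi hα (inv_pos.2 hpos),
          ENNReal.toReal_ofReal (Real.rpow_nonneg (inv_pos.2 hpos).le _),
          Real.inv_rpow hpos.le, Real.rpow_neg hpos.le, inv_inv]
    have h3 := h1.integral_prod_right
    rw [integral_prod_symm _ h1] at h2
    simp only [hinner] at h2 h3
    refine ⟨h3, Eq.trans (integral_congr_ae ?_) h2⟩
    filter_upwards [RegVar.ae_one_lt_tailField hN hXm hXrv hYm hY] with ω hω
    have hne : (N (Y 0 ω))⁻¹ ≠ 0 := inv_ne_zero (zero_lt_one.trans hω).ne'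
    -- The value at s of the shifted field is Y(0), so the normalization by `h` produces exactly the
    -- shifted spectral field.
    have hgh : (g ∘ h) (fun t => Y (t - s) ω) =
        g (fun t => RegVar.spectralField N Y (t - s) ω) := by
      simp only [Function.comp, h, sub_self, RegVar.spectralField]
    have hiff : RegVar.spectralField N Y (-s) ω ≠ 0 ↔ Y (-s) ω ≠ 0 := by
      simp only [RegVar.spectralField, ne_eq, smul_eq_zero, hne, false_or]
    have hset : ω ∈ {ω | RegVar.spectralField N Y (-s) ω ≠ 0} ↔ ω ∈ {ω | Y (-s) ω ≠ 0} := hiff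
    rw [hgh]
    congr 1
    by_cases hc : ω ∈ {ω | Y (-s) ω ≠ 0}
    · rw [indicator_of_mem hc, indicator_of_mem (hset.2 hc)]
    · rw [indicator_of_notMem hc, indicator_of_notMem (mt hset.1 hc)]
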